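/- For a random variable $X\ge 0$ with finite moments $m_n=\mathbf E X^n$, $n=1,2,\dots$, call $X$ M-determinate if its law is the only probability distribution on $[0,\infty)$ with all moments finite and equal to $m_n$, $n\ge 1$. There exists an (almost surely) positive M-determinate random variable $X$ whose moments satisfy Carleman's condition $$\sum_{n=1}^{\infty} m_n^{-1/(2n)}=\infty$$ but do not satisfy the quadratic growth condition $$\frac{m_{n+1}}{m_n}=\mathcal O\big((n+1)^2\big),\qquad n\to\infty .$$ Explicitly, if $\xi_1,\eta_1,\xi_2,\eta_2$ are independent random variables on a probability space (which exist), each exponentially distributed with parameter $1$, then $X=\xi_1\ln(1+\eta_1)\cdot\xi_2\ln(1+\eta_2)$ has all these properties, and its moments are finite and equal to $$m_n=(n!\,K_n)^2,\qquad K_n=\int_0^\infty [\ln(1+x)]^n e^{-x}\,dx,\qquad n=0,1,2,\dots .$$ -/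

import Mathlib

open MeasureTheory ProbabilityTheory Filter Set
open scoped Topology Nat

/-- A measure on the line all of whose power moments are finite. -/
def HasFiniteMoments (μ : Measure ℝ) : Prop :=
  ∀ n : ℕ, Integrable (fun x : ℝ => x ^ n) μ

/-- M-determinacy (Stieltjes moment problem) of a distribution `μ` on the half-line `[0, ∞)`:
`μ` is a probability distribution concentrated on `[0, ∞)` with finite moments, and it is the only
such distribution with its moment sequence. -/
def IsMDeterminate (μ : Measure ℝ) : Prop :=
  IsProbabilityMeasure μ ∧ μ (Iio 0) = 0 ∧ HasFiniteMoments μ ∧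
    ∀ ν : Measure ℝ, IsProbabilityMeasure ν → ν (Iio 0) = 0 → HasFiniteMoments ν →
      (∀ n : ℕ, ∫ x, x ^ n ∂ν = ∫ x, x ^ n ∂μ) → ν = μ

/-- Carleman's condition `∑_{n ≥ 1} m_n ^ (-1/(2n)) = ∞` for a sequence of positive moments. -/
def CarlemanCondition (m : ℕ → ℝ) : Prop :=
  Tendsto (fun N : ℕ => ∑ n ∈ Finset.Icc 1 N, (m n) ^ (-(1 / (2 * (n : ℝ))))) atTop atTop

/-- The quadratic growth condition `m_{n+1} / m_n = O((n+1)^2)` as `n → ∞`. -/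
def QuadraticGrowth (m : ℕ → ℝ) : Prop :=
  (fun n : ℕ => m (n + 1) / m n) =O[atTop] (fun n : ℕ => ((n : ℝ) + 1) ^ 2)

/-- A family of independent random variables, each exponentially distributed with parameter 1. -/
structure IsIIDStdExp {Ω ι : Type*} [MeasurableSpace Ω] (P : Measure Ω) (ζ : ι → Ω → ℝ) :
    Prop where
  measurable : ∀ i, Measurable (ζ i)
  law : ∀ i, P.map (ζ i) = expMeasure 1
  indep : iIndepFun ζ P

/-- The random variable `ξ₁ ln(1 + η₁) · ξ₂ ln(1 + η₂)`. -/
noncomputable def logProduct {Ω : Type*} (ξ₁ η₁ ξ₂ η₂ : Ω → ℝ) (ω : Ω) : ℝ :=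
  (ξ₁ ω * Real.log (1 + η₁ ω)) * (ξ₂ ω * Real.log (1 + η₂ ω))

/-- `K_n = ∫₀^∞ (ln(1 + x))^n e^{-x} dx`. -/
noncomputable def logMoment (n : ℕ) : ℝ :=
  ∫ x in Ioi (0 : ℝ), Real.log (1 + x) ^ n * Real.exp (-x)

/-! By independence the moments are `(n! K_n)^2`, so everything depends on the size of `K_n`.
Splitting at scale `a = 2n + 3` gives `K_n ≤ 2 (log (2n + 3))^n`. Discarding the integral below `s`
gives `K_n ≥ (log (1 + s))^n e^{-s}` for every `s ≥ 0`.

The lower bound defeats quadratic growth: dividing `m_{n+1} / m_n` by `(n + 1)^2` leaves `(K_{n+1} /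
K_n)^2`, and if this were bounded, `K_n` would grow at most geometrically. The upper bound gives
Carleman's condition, since `m_n^{-1/(2n)}` is then at least a constant times `1 / (n log (n + 3))`.

Determinacy is proved directly from the upper bound. The cosine transform `∫ cos (t √x) dμ` is
smooth in `t`; its derivatives at `0` are zero or signed integer moments, and its `n`-th derivative
is bounded by `∫ √x^n dμ`, hence by a multiple of `n! (log (n + 3))^n`. Successive ratios of this
weight are at most `e (n + 1) log (n + 4)`, whose reciprocals have divergent sum. The difference of
two transforms with the same moments is therefore a flat function in a quasi-analytic class and
vanishes by Bang's argument (`eq_zero_of_derivative_chain`). The transform determines the law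
through characteristic functions. -/

/-! ### Quasi-analyticity by Bang's method -/

/-- One step of Bang's argument: a bound on all the derivatives at `a`, of order less than `N`,
propagates to the right of `a` with exponential growth. -/
theorem norm_le_of_derivative_chain {E : Type*} [NormedAddCommGroup E] [NormedSpace ℝ E]
    {f : ℕ → ℝ → E}
    (hf : ∀ n t, HasDerivAt (f n) (f (n + 1) t) t) {M : ℕ → ℝ} (hM0 : ∀ n, 0 ≤ M n)
    {N : ℕ} (hfM : ∀ t, ‖f N t‖ ≤ M N) {l : ℝ}
    (hMl : ∀ n < N, M (n + 1) ≤ l * M n) (hl : 0 < l) {a D : ℝ}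
    (hD : Real.exp (-N) ≤ D) (ha : ∀ n, ‖f n a‖ ≤ D * Real.exp n * M n) :
    ∀ n ≤ N, ∀ t, a ≤ t →
      ‖f n t‖ ≤ D * Real.exp n * M n * Real.exp (Real.exp 1 * l * (t - a)) := by
  have hD0 : 0 < D := (Real.exp_pos _).trans_le hD
  intro n hn
  induction hn using Nat.decreasingInduction with
  | self =>
    intro t ht
    have h1 : 1 ≤ D * Real.exp N := by
      calc (1 : ℝ) = Real.exp (-N) * Real.exp N := by rw [← Real.exp_add]; simp
        _ ≤ _ := by gcongr
    have h2 : 1 ≤ Real.exp (Real.exp 1 * l * (t - a)) :=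
      Real.one_le_exp (by have := sub_nonneg.2 ht; positivity)
    calc ‖f N t‖ ≤ M N := hfM t
      _ = 1 * M N * 1 := by ring
      _ ≤ _ := by have := hM0 N; gcongr
  | of_succ n hn ih =>
    intro t ht
    have hder : ∀ x, HasDerivAt
        (fun t => D * Real.exp n * M n * Real.exp (Real.exp 1 * l * (t - a)))
        (D * Real.exp n * M n * (Real.exp (Real.exp 1 * l * (x - a)) * (Real.exp 1 * l))) x := by
      intro x
      have h := (((hasDerivAt_id x).sub_const a).const_mul (Real.exp 1 * l)).exp.const_mul
        (D * Real.exp n * M n)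
      simpa using h
    -- The majorant has logarithmic derivative `e l`: the factor `e` pays for `exp (n + 1)` against
    -- `exp n`, and `l` for `M (n + 1)` against `M n`.
    refine image_norm_le_of_norm_deriv_right_le_deriv_boundary (a := a) (b := t) (f := f n)
      (f' := f (n + 1)) (fun x _ => (hf n x).continuousAt.continuousWithinAt)
      (fun x _ => (hf n x).hasDerivWithinAt) (by simpa using ha n) hder ?_ ⟨ht, le_rfl⟩
    intro x hx
    refine (ih x hx.1).trans ?_
    have h1 := hMl n hn
    have h2 : Real.exp ((n + 1 : ℕ) : ℝ) = Real.exp n * Real.exp 1 := by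
      rw [← Real.exp_add]; push_cast; rfl
    rw [h2]
    calc _ ≤ D * (Real.exp n * Real.exp 1) * (l * M n) * Real.exp (Real.exp 1 * l * (x - a)) := by
          gcongr
      _ = _ := by ring

/-- Bang's form of the Denjoy–Carleman theorem: a function in a quasi-analytic class that is flat
at the origin vanishes on the half-line. -/
theorem eq_zero_of_derivative_chain {E : Type*} [NormedAddCommGroup E] [NormedSpace ℝ E]
    {f : ℕ → ℝ → E} (hf : ∀ n t, HasDerivAt (f n) (f (n + 1) t) t) {M l : ℕ → ℝ}
    (hfM : ∀ n t, ‖f n t‖ ≤ M n) (hl : ∀ n, 0 < l n) (hmono : Monotone l)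
    (hMl : ∀ n, M (n + 1) ≤ l n * M n)
    (hdiv : Tendsto (fun N => ∑ n ∈ Finset.range N, (l n)⁻¹) atTop atTop)
    (h0 : ∀ n, f n 0 = 0) {t : ℝ} (ht : 0 ≤ t) : f 0 t = 0 := by
  have hM0 : ∀ n, 0 ≤ M n := fun n => (norm_nonneg _).trans (hfM n 0)
  -- Flatness at `0` means a gain `e^{-k}` for every `k`. Moving right by `1 / (e l_k)` costs one
  -- factor `e`, so the gain drops from `k + 1` to `k`; the interval on which gain `k` survives is
  -- the sum of such steps.
  have key : ∀ j k : ℕ, ∀ t : ℝ, 0 ≤ t →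
      t ≤ (Real.exp 1)⁻¹ * ∑ i ∈ Finset.range j, (l (k + i))⁻¹ →
      ∀ n, ‖f n t‖ ≤ Real.exp (-k) * Real.exp n * M n := by
    intro j
    induction j with
    | zero =>
      intro k t h1 h2 n
      have : t = 0 := le_antisymm (by simpa using h2) h1
      rw [this, h0, norm_zero]
      have := hM0 n
      positivity
    | succ j ih =>
      intro k t h1 h2 n
      -- Above order `k` the factor `e^{n - k}` is at least `1`, so the global bound suffices.
      rcases le_or_gt n k with hn | hn
      swap
      · have : 1 ≤ Real.exp (-k) * Real.exp n := by
          rw [← Real.exp_add]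
          apply Real.one_le_exp
          have : (k : ℝ) ≤ n := by exact_mod_cast hn.le
          linarith
        calc ‖f n t‖ ≤ 1 * M n := by simpa using hfM n t
          _ ≤ _ := by have := hM0 n; gcongr
      set s := (Real.exp 1)⁻¹ * ∑ i ∈ Finset.range j, (l (k + 1 + i))⁻¹ with hs
      have hs0 : 0 ≤ s := by
        have : ∀ i ∈ Finset.range j, 0 ≤ (l (k + 1 + i))⁻¹ := fun i _ => (inv_pos.2 (hl _)).le
        have := Finset.sum_nonneg this
        positivity
      have hst : t ≤ s + (Real.exp 1)⁻¹ * (l k)⁻¹ := by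
        rw [Finset.sum_range_succ'] at h2
        simp only [add_zero] at h2
        rw [hs, ← mul_add]
        simpa [add_assoc, add_comm, add_left_comm] using h2
      set a := min t s with ha
      have ha0 : 0 ≤ a := le_min h1 hs0
      have hak : ∀ n, ‖f n a‖ ≤ Real.exp (-(k + 1 : ℕ)) * Real.exp n * M n :=
        ih (k + 1) a ha0 (min_le_right _ _)
      have hta : t - a ≤ (Real.exp 1)⁻¹ * (l k)⁻¹ := by
        rcases min_cases t s with h | h
        · rw [ha, h.1, sub_self]; have := hl k; positivity
        · rw [ha, h.1]; linarith
      have hexp : Real.exp (Real.exp 1 * l k * (t - a)) ≤ Real.exp 1 := by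
        apply Real.exp_le_exp.2
        calc _ ≤ Real.exp 1 * l k * ((Real.exp 1)⁻¹ * (l k)⁻¹) := by
              have := hl k; gcongr
          _ = 1 := by have := (hl k).ne'; field_simp
      have h3 := norm_le_of_derivative_chain hf hM0 (N := k + 1) (hfM (k + 1)) (l := l k)
        (fun n hn => (hMl n).trans (mul_le_mul_of_nonneg_right (hmono (by omega)) (hM0 n)))
        (hl k) (a := a) (D := Real.exp (-(k + 1 : ℕ))) le_rfl hak n (by omega) t (min_le_left _ _)
      refine h3.trans ?_
      have h4 : Real.exp (-(k + 1 : ℕ)) * Real.exp 1 = Real.exp (-k) := by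
        rw [← Real.exp_add]; congr 1; push_cast; ring
      calc _ ≤ Real.exp (-(k + 1 : ℕ)) * Real.exp n * M n * Real.exp 1 := by
            have := hM0 n; gcongr
        _ = (Real.exp (-(k + 1 : ℕ)) * Real.exp 1) * Real.exp n * M n := by ring
        _ = _ := by rw [h4]
  have hbound : ∀ k : ℕ, ‖f 0 t‖ ≤ Real.exp (-k) * M 0 := by
    intro k
    -- Divergence of the tail from `k` on makes the interval for gain `k` reach `t`.
    obtain ⟨N, hN, hkN⟩ := ((hdiv.eventually_ge_atTop
      (Real.exp 1 * t + ∑ i ∈ Finset.range k, (l i)⁻¹)).and (eventually_ge_atTop k)).exists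
    have h := key (N - k) k t ht ?_ 0
    · simpa using h
    rw [← Nat.add_sub_cancel' hkN, Finset.sum_range_add] at hN
    rw [← div_eq_inv_mul, le_div_iff₀ (Real.exp_pos 1)]
    linarith
  have hlim : Tendsto (fun k : ℕ => Real.exp (-(k : ℝ)) * M 0) atTop (𝓝 0) := by
    simpa using (Real.tendsto_exp_neg_atTop_nhds_zero.comp
      tendsto_natCast_atTop_atTop).mul_const (M 0)
  exact norm_le_zero_iff.1 (ge_of_tendsto' hlim hbound)

/-! ### The cosine transform and uniqueness for the Stieltjes problem -/

theorem sqrt_pow_le (x : ℝ) (n : ℕ) : √x ^ n ≤ 1 + ‖x ^ n‖ := by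
  rw [norm_pow, Real.norm_eq_abs]
  rcases le_total (√x) 1 with h | h
  · have := pow_le_one₀ (n := n) (Real.sqrt_nonneg x) h
    have : 0 ≤ |x| ^ n := by positivity
    linarith
  · have h1 : √x ≤ |x| := by
      calc √x ≤ √x * √x := le_mul_of_one_le_left (by positivity) h
        _ ≤ |x| := by
          rcases le_total 0 x with h0 | h0
          · rw [Real.mul_self_sqrt h0, abs_of_nonneg h0]
          · simp [Real.sqrt_eq_zero_of_nonpos h0]
    have : √x ^ n ≤ |x| ^ n := by gcongr
    linarith

theorem HasFiniteMoments.integrable_sqrt_pow {μ : Measure ℝ} [IsFiniteMeasure μ]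
    (h : HasFiniteMoments μ) (n : ℕ) : Integrable (fun x => √x ^ n) μ := by
  refine ((integrable_const (1 : ℝ)).add (h n).norm).mono' (by fun_prop) (ae_of_all _ fun x => ?_)
  rw [Real.norm_of_nonneg (by positivity)]
  exact sqrt_pow_le x n

/-- The `n`-th derivative in `t` of `∫ cos (t √x) dμ(x)`. -/
noncomputable def cosTransform (μ : Measure ℝ) (n : ℕ) (t : ℝ) : ℝ :=
  ∫ x, √x ^ n * Real.cos (t * √x + n * (Real.pi / 2)) ∂μ

theorem HasFiniteMoments.integrable_cosTransform {μ : Measure ℝ} [IsFiniteMeasure μ]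
    (h : HasFiniteMoments μ) (n : ℕ) (t : ℝ) :
    Integrable (fun x => √x ^ n * Real.cos (t * √x + n * (Real.pi / 2))) μ := by
  refine (h.integrable_sqrt_pow n).mono' (by fun_prop) (ae_of_all _ fun x => ?_)
  rw [norm_mul, Real.norm_of_nonneg (by positivity : 0 ≤ √x ^ n)]
  exact mul_le_of_le_one_right (by positivity) (Real.abs_cos_le_one _)

theorem HasFiniteMoments.hasDerivAt_cosTransform {μ : Measure ℝ} [IsFiniteMeasure μ]
    (h : HasFiniteMoments μ) (n : ℕ) (t : ℝ) :
    HasDerivAt (cosTransform μ n) (cosTransform μ (n + 1) t) t := by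
  refine (hasDerivAt_integral_of_dominated_loc_of_deriv_le (s := univ) univ_mem
    (F := fun t x => √x ^ n * Real.cos (t * √x + n * (Real.pi / 2)))
    (F' := fun t x => √x ^ (n + 1) * Real.cos (t * √x + (n + 1 : ℕ) * (Real.pi / 2)))
    (bound := fun x => √x ^ (n + 1))
    (Eventually.of_forall fun t => (h.integrable_cosTransform n t).aestronglyMeasurable)
    (h.integrable_cosTransform n t) (h.integrable_cosTransform (n + 1) t).aestronglyMeasurable
    (ae_of_all _ fun x t _ => ?_) (h.integrable_sqrt_pow (n + 1))
    (ae_of_all _ fun x t _ => ?_)).2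
  · rw [norm_mul, Real.norm_of_nonneg (by positivity : 0 ≤ √x ^ (n + 1))]
    exact mul_le_of_le_one_right (by positivity) (Real.abs_cos_le_one _)
  · have h0 : HasDerivAt (fun t : ℝ => t * √x + n * (Real.pi / 2)) (1 * √x) t :=
      ((hasDerivAt_id t).mul_const (√x)).add_const _
    refine (h0.cos.const_mul (√x ^ n)).congr_deriv ?_
    have : t * √x + (n + 1 : ℕ) * (Real.pi / 2) = (t * √x + n * (Real.pi / 2)) + Real.pi / 2 := by
      push_cast; ring
    rw [this, Real.cos_add_pi_div_two, pow_succ]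
    ring

theorem HasFiniteMoments.abs_cosTransform_le {μ : Measure ℝ} [IsFiniteMeasure μ]
    (h : HasFiniteMoments μ) (n : ℕ) (t : ℝ) : |cosTransform μ n t| ≤ ∫ x, √x ^ n ∂μ := by
  rw [← Real.norm_eq_abs]
  refine norm_integral_le_of_norm_le (h.integrable_sqrt_pow n) (ae_of_all _ fun x => ?_)
  rw [norm_mul, Real.norm_of_nonneg (by positivity : 0 ≤ √x ^ n)]
  exact mul_le_of_le_one_right (by positivity) (Real.abs_cos_le_one _)

theorem sqrt_pow_two_mul {x : ℝ} (hx : 0 ≤ x) (k : ℕ) : √x ^ (2 * k) = x ^ k := by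
  rw [pow_mul, Real.sq_sqrt hx]

theorem ae_nonneg_of_measure_Iio {μ : Measure ℝ} (h : μ (Iio 0) = 0) : ∀ᵐ x ∂μ, 0 ≤ x := by
  rw [ae_iff]
  simp only [not_le]
  exact h

/-- At `t = 0` the half-integer moments, which are not given, occur only at odd orders, where the
cosine factor is zero. Equal integer moments thus give equal derivatives of every order. -/
theorem cosTransform_zero_right {μ : Measure ℝ} (hμ : μ (Iio 0) = 0) (n : ℕ) :
    cosTransform μ n 0 = (if Even n then ∫ x, x ^ (n / 2) ∂μ else 0) *
      Real.cos (n * (Real.pi / 2)) := by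
  unfold cosTransform
  simp only [zero_mul, zero_add]
  rw [integral_mul_const]
  rcases Nat.even_or_odd' n with ⟨k, rfl | rfl⟩
  · congr 1
    rw [if_pos (even_two_mul k), Nat.mul_div_cancel_left k two_pos]
    refine integral_congr_ae ?_
    filter_upwards [ae_nonneg_of_measure_Iio hμ] with x hx using sqrt_pow_two_mul hx k
  · have : Real.cos ((2 * k + 1 : ℕ) * (Real.pi / 2)) = 0 := by
      rw [Real.cos_eq_zero_iff]
      exact ⟨k, by push_cast; ring⟩
    rw [this, mul_zero, mul_zero]

/-- Twice the symmetrization of the law of the square root. -/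
noncomputable def sqrtSymm (μ : Measure ℝ) : Measure ℝ :=
  μ.map (fun x => √x) + μ.map (fun x => -√x)

instance (μ : Measure ℝ) [IsFiniteMeasure μ] : IsFiniteMeasure (sqrtSymm μ) := by
  unfold sqrtSymm; infer_instance

theorem charFun_sqrtSymm (μ : Measure ℝ) [IsFiniteMeasure μ] (t : ℝ) :
    charFun (sqrtSymm μ) t = ((2 * cosTransform μ 0 t : ℝ) : ℂ) := by
  have hint : ∀ (ν : Measure ℝ) [IsFiniteMeasure ν] (g : ℝ → ℝ), Measurable g →
      Integrable (fun x : ℝ => Complex.exp (t * g x * Complex.I)) ν := by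
    intro ν _ g hg
    refine (integrable_const (1 : ℝ)).mono' (by fun_prop) (ae_of_all _ fun x => ?_)
    rw [← Complex.ofReal_mul, Complex.norm_exp_ofReal_mul_I]
  have hs : Measurable (fun x : ℝ => √x) := by fun_prop
  have hs' : Measurable (fun x : ℝ => -√x) := by fun_prop
  rw [charFun_apply_real, sqrtSymm, integral_add_measure (hint _ (fun x => x) measurable_id)
    (hint _ (fun x => x) measurable_id), integral_map hs.aemeasurable (by fun_prop),
    integral_map hs'.aemeasurable (by fun_prop), ← integral_add (hint _ _ hs)
    (hint _ _ hs'), cosTransform, ← integral_const_mul, ← integral_complex_ofReal]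
  refine integral_congr_ae (ae_of_all _ fun x => ?_)
  simp only [pow_zero, one_mul, Nat.cast_zero, zero_mul, add_zero, Complex.ofReal_mul,
    Complex.ofReal_cos, Complex.ofReal_neg, Complex.ofReal_ofNat]
  rw [Complex.two_cos]
  congr 2
  ring

theorem map_sq_sqrtSymm {μ : Measure ℝ} (hμ : μ (Iio 0) = 0) :
    (sqrtSymm μ).map (fun x => x ^ 2) = μ + μ := by
  have hs : Measurable (fun x : ℝ => √x) := by fun_prop
  have hs' : Measurable (fun x : ℝ => -√x) := by fun_prop
  have hq : Measurable (fun x : ℝ => x ^ 2) := by fun_prop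
  have key : ∀ g : ℝ → ℝ, (∀ x, 0 ≤ x → g x = x) → μ.map g = μ := by
    intro g hg
    have : g =ᵐ[μ] id := by
      filter_upwards [ae_nonneg_of_measure_Iio hμ] with x hx using hg x hx
    rw [Measure.map_congr this, Measure.map_id]
  rw [sqrtSymm, Measure.map_add _ _ hq, Measure.map_map hq hs, Measure.map_map hq hs',
    key _ fun x hx => by simp [hx], key _ fun x hx => by simp [hx]]

/-- Symmetrizing the law of `√x` makes its characteristic function twice the cosine transform;
squaring then forgets the sign and recovers the law doubled. -/
theorem eq_of_cosTransform_eq {μ ν : Measure ℝ} [IsFiniteMeasure μ] [IsFiniteMeasure ν]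
    (hμ : μ (Iio 0) = 0) (hν : ν (Iio 0) = 0)
    (h : ∀ t, 0 ≤ t → cosTransform μ 0 t = cosTransform ν 0 t) : μ = ν := by
  have heven : ∀ (ρ : Measure ℝ) t, cosTransform ρ 0 (-t) = cosTransform ρ 0 t := by
    intro ρ t
    simp [cosTransform]
  have h1 : sqrtSymm μ = sqrtSymm ν := by
    apply Measure.ext_of_charFun
    funext t
    rw [charFun_sqrtSymm, charFun_sqrtSymm]
    rcases le_total 0 t with ht | ht
    · rw [h t ht]
    · rw [← heven μ, ← heven ν, h (-t) (by linarith)]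
  have h2 : μ + μ = ν + ν := by rw [← map_sq_sqrtSymm hμ, h1, map_sq_sqrtSymm hν]
  ext s _
  have h3 : μ s + μ s = ν s + ν s := by
    rw [← Measure.add_apply, h2, Measure.add_apply]
  rw [← two_mul, ← two_mul] at h3
  exact (ENNReal.mul_right_inj two_ne_zero ENNReal.ofNat_ne_top).1 h3

/-- Uniqueness in the Stieltjes moment problem when the half-integer moments are bounded by a
quasi-analytic weight. -/
theorem eq_of_moments_eq {μ ν : Measure ℝ} [IsFiniteMeasure μ] [IsFiniteMeasure ν]
    (hμ : μ (Iio 0) = 0) (hν : ν (Iio 0) = 0) (hμm : HasFiniteMoments μ)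
    (hνm : HasFiniteMoments ν) (hmom : ∀ n : ℕ, ∫ x, x ^ n ∂ν = ∫ x, x ^ n ∂μ)
    {M l : ℕ → ℝ} (hμM : ∀ n, ∫ x, √x ^ n ∂μ ≤ M n) (hνM : ∀ n, ∫ x, √x ^ n ∂ν ≤ M n)
    (hl : ∀ n, 0 < l n) (hmono : Monotone l) (hMl : ∀ n, M (n + 1) ≤ l n * M n)
    (hdiv : Tendsto (fun N => ∑ n ∈ Finset.range N, (l n)⁻¹) atTop atTop) : ν = μ := by
  refine eq_of_cosTransform_eq hν hμ fun t ht => ?_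
  have := eq_zero_of_derivative_chain (f := fun n t => cosTransform ν n t - cosTransform μ n t)
    (M := fun n => 2 * M n) (l := l)
    (fun n t => (hνm.hasDerivAt_cosTransform n t).sub (hμm.hasDerivAt_cosTransform n t))
    (fun n t => ?_) hl hmono (fun n => by have := hMl n; linarith) hdiv (fun n => ?_) ht
  · exact sub_eq_zero.1 this
  · refine (norm_sub_le _ _).trans ?_
    have h1 := (hνm.abs_cosTransform_le n t).trans (hνM n)
    have h2 := (hμm.abs_cosTransform_le n t).trans (hμM n)
    simp only [Real.norm_eq_abs]
    linarith
  · simp only [cosTransform_zero_right hμ, cosTransform_zero_right hν, hmom, sub_self]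

/-! ### The weight and the determinacy criterion -/

theorem one_le_log_of_three_le {x : ℝ} (hx : 3 ≤ x) : 1 ≤ Real.log x := by
  rw [Real.le_log_iff_exp_le (by linarith)]
  exact (Real.exp_one_lt_d9.le.trans (by norm_num)).trans hx

theorem log_add_one_le {x : ℝ} (hx : 0 < x) : Real.log (x + 1) ≤ Real.log x + 1 / x := by
  have h := Real.log_le_sub_one_of_pos (show 0 < (x + 1) / x by positivity)
  rw [Real.log_div (by positivity) hx.ne'] at h
  have : (x + 1) / x - 1 = 1 / x := by field_simp; ring
  linarith

/-- Each term dominates an increment of `log log (n + 4)`, and the increments telescope. -/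
theorem tendsto_sum_inv_mul_log :
    Tendsto (fun N => ∑ n ∈ Finset.range N, (((n : ℝ) + 1) * Real.log (n + 4))⁻¹) atTop atTop := by
  have hstep : ∀ n : ℕ, Real.log (Real.log ((n + 1 : ℕ) + 4)) - Real.log (Real.log (n + 4)) ≤
      (((n : ℝ) + 1) * Real.log (n + 4))⁻¹ := by
    intro n
    have hn : (0 : ℝ) ≤ n := n.cast_nonneg
    have h1 := one_le_log_of_three_le (show (3 : ℝ) ≤ n + 4 by linarith)
    have h2 := one_le_log_of_three_le (show (3 : ℝ) ≤ (n + 1 : ℕ) + 4 by push_cast; linarith)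
    have h3 := log_add_one_le (show (0 : ℝ) < n + 4 by linarith)
    rw [← Real.log_div (by linarith) (by linarith)]
    refine (Real.log_le_sub_one_of_pos (by positivity)).trans ?_
    have h4 : Real.log ((n + 1 : ℕ) + 4) ≤ Real.log (n + 4) + 1 / (n + 1) := by
      have e : ((n + 1 : ℕ) : ℝ) + 4 = n + 4 + 1 := by push_cast; ring
      have : 1 / ((n : ℝ) + 4) ≤ 1 / (n + 1) := by gcongr; linarith
      rw [e]; linarith
    calc _ ≤ (Real.log (n + 4) + 1 / (n + 1)) / Real.log (n + 4) - 1 := by gcongr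
      _ = _ := by field_simp; ring
  have hsum : ∀ N : ℕ, Real.log (Real.log (N + 4)) - Real.log (Real.log 4) ≤
      ∑ n ∈ Finset.range N, (((n : ℝ) + 1) * Real.log (n + 4))⁻¹ := by
    intro N
    refine le_trans (le_of_eq ?_) (Finset.sum_le_sum fun n _ => hstep n)
    rw [Finset.sum_range_sub (fun n : ℕ => Real.log (Real.log (n + 4)))]
    simp
  refine tendsto_atTop_mono hsum (tendsto_atTop_add_const_right _ _ ?_)
  exact Real.tendsto_log_atTop.comp (Real.tendsto_log_atTop.comp
    (tendsto_atTop_add_const_right _ _ tendsto_natCast_atTop_atTop))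

/-- The weight sequence `n! (log (n + 3)) ^ n`. -/
noncomputable def logWeight (n : ℕ) : ℝ := n ! * Real.log (n + 3) ^ n

theorem one_le_log_natCast_add_three (n : ℕ) : 1 ≤ Real.log ((n : ℝ) + 3) :=
  one_le_log_of_three_le (by have : (0 : ℝ) ≤ n := n.cast_nonneg; linarith)

theorem logWeight_pos (n : ℕ) : 0 < logWeight n := by
  have := one_le_log_natCast_add_three n
  have : (0 : ℝ) < n ! := by exact_mod_cast n.factorial_pos
  unfold logWeight
  positivity

/-- The ratio `log (n + 4) / log (n + 3)` is at most `1 + 1 / (n + 3)`, so its `n`-th power stays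
below `e`. -/
theorem logWeight_succ_le (n : ℕ) :
    logWeight (n + 1) ≤ Real.exp 1 * (((n : ℝ) + 1) * Real.log (n + 4)) * logWeight n := by
  have hL := one_le_log_natCast_add_three n
  have hn : (0 : ℝ) ≤ n := n.cast_nonneg
  have hL' := one_le_log_of_three_le (show (3 : ℝ) ≤ n + 4 by linarith)
  have h1 : Real.log ((n : ℝ) + 4) ≤ Real.log (n + 3) * (1 / (n + 3) + 1) := by
    have h := log_add_one_le (show (0 : ℝ) < n + 3 by linarith)
    have e : (n : ℝ) + 4 = n + 3 + 1 := by ring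
    have h2 : 1 / ((n : ℝ) + 3) ≤ Real.log (n + 3) * (1 / (n + 3)) :=
      le_mul_of_one_le_left (by positivity) hL
    rw [e]; linarith
  have h2 : Real.log ((n : ℝ) + 4) ^ n ≤ Real.exp 1 * Real.log (n + 3) ^ n := by
    calc _ ≤ (Real.log (n + 3) * (1 / (n + 3) + 1)) ^ n := by gcongr
      _ ≤ (Real.log (n + 3) * Real.exp (1 / (n + 3))) ^ n := by
          gcongr
          exact Real.add_one_le_exp _
      _ = Real.exp (n * (1 / (n + 3))) * Real.log (n + 3) ^ n := by
          rw [mul_pow, ← Real.exp_nat_mul, mul_comm]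
      _ ≤ _ := by
          gcongr
          rw [mul_one_div, div_le_one (by linarith)]
          linarith
  unfold logWeight
  have e : ((n + 1 : ℕ) : ℝ) + 3 = n + 4 := by push_cast; ring
  rw [e, Nat.factorial_succ, pow_succ, Nat.cast_mul, Nat.cast_succ]
  calc ((n : ℝ) + 1) * n ! * (Real.log (n + 4) ^ n * Real.log (n + 4))
      ≤ ((n : ℝ) + 1) * n ! * ((Real.exp 1 * Real.log (n + 3) ^ n) * Real.log (n + 4)) := by
        gcongr
    _ = _ := by ring

theorem mul_logWeight_le_succ (n : ℕ) :
    ((n : ℝ) + 1) * Real.log (n + 3) * logWeight n ≤ logWeight (n + 1) := by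
  have hL := one_le_log_natCast_add_three n
  have h : Real.log ((n : ℝ) + 3) ≤ Real.log ((n + 1 : ℕ) + 3) :=
    Real.log_le_log (by positivity) (by push_cast; linarith)
  unfold logWeight
  rw [Nat.factorial_succ, Nat.cast_mul, Nat.cast_succ]
  calc _ = ((n : ℝ) + 1) * n ! * Real.log (n + 3) ^ (n + 1) := by ring
    _ ≤ _ := by rw [Nat.cast_succ] at h; gcongr

/-- Half-integer moments are interpolated by `√x ≤ c / 2 + x / (2c)`. Taking `c` comparable to the
ratio of consecutive weights makes both terms of order `logWeight (2 * k + 1)`; they contribute `2`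
and `24`. -/
theorem integral_sqrt_pow_le_logWeight {μ : Measure ℝ} [IsFiniteMeasure μ] (hμ : μ (Iio 0) = 0)
    (hm : HasFiniteMoments μ) (hW : ∀ k : ℕ, ∫ x, x ^ k ∂μ ≤ 4 * logWeight (2 * k)) (n : ℕ) :
    ∫ x, √x ^ n ∂μ ≤ 26 * logWeight n := by
  have h0 := ae_nonneg_of_measure_Iio hμ
  rcases Nat.even_or_odd' n with ⟨k, rfl | rfl⟩
  · calc ∫ x, √x ^ (2 * k) ∂μ = ∫ x, x ^ k ∂μ := integral_congr_ae (by
          filter_upwards [h0] with x hx using sqrt_pow_two_mul hx k)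
      _ ≤ _ := (hW k).trans (by have := logWeight_pos (2 * k); linarith)
  · set c : ℝ := ((2 * k : ℕ) + 1) * Real.log ((2 * k : ℕ) + 3) with hc
    have hL := one_le_log_natCast_add_three (2 * k)
    have hc0 : 0 < c := by positivity
    have h1 : ∫ x, √x ^ (2 * k + 1) ∂μ ≤ ∫ x, (c / 2 * x ^ k + 1 / (2 * c) * x ^ (k + 1)) ∂μ := by
      refine integral_mono_ae (hm.integrable_sqrt_pow _)
        (((hm k).const_mul _).add ((hm (k + 1)).const_mul _)) ?_
      filter_upwards [h0] with x hx
      have hy : √x ≤ c / 2 + 1 / (2 * c) * x := by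
        have : 0 ≤ (c - √x) ^ 2 / (2 * c) := by positivity
        have e : (c - √x) ^ 2 / (2 * c) = c / 2 + 1 / (2 * c) * √x ^ 2 - √x := by
          field_simp; ring
        rw [e, Real.sq_sqrt hx] at this
        linarith
      calc √x ^ (2 * k + 1) = x ^ k * √x := by rw [pow_succ, sqrt_pow_two_mul hx]
        _ ≤ x ^ k * (c / 2 + 1 / (2 * c) * x) := by gcongr
        _ = _ := by ring
    rw [integral_add ((hm k).const_mul _) ((hm (k + 1)).const_mul _), integral_const_mul,
      integral_const_mul] at h1
    have h2 : c * logWeight (2 * k) ≤ logWeight (2 * k + 1) := mul_logWeight_le_succ _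
    -- Here `12 = 3 * 2 * 2`: a bound for `e`, one for the linear factor and one for the logarithm.
    have h3 : logWeight (2 * (k + 1)) ≤ 12 * c * logWeight (2 * k + 1) := by
      refine (logWeight_succ_le (2 * k + 1)).trans ?_
      refine mul_le_mul_of_nonneg_right ?_ (logWeight_pos _).le
      have hlog : Real.log ((2 * k + 1 : ℕ) + 4) ≤ 2 * Real.log ((2 * k : ℕ) + 3) := by
        rw [← Nat.cast_two (R := ℝ), ← Real.log_pow]
        refine Real.log_le_log (by positivity) ?_
        have : (0 : ℝ) ≤ k := k.cast_nonneg
        push_cast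
        nlinarith
      have he : Real.exp 1 ≤ 3 := Real.exp_one_lt_d9.le.trans (by norm_num)
      have hk : ((2 * k + 1 : ℕ) : ℝ) + 1 ≤ 2 * ((2 * k : ℕ) + 1) := by
        have : (0 : ℝ) ≤ k := k.cast_nonneg
        push_cast
        linarith
      calc _ ≤ 3 * ((2 * ((2 * k : ℕ) + 1)) * (2 * Real.log ((2 * k : ℕ) + 3))) := by
            have : 0 ≤ Real.log (((2 * k + 1 : ℕ) : ℝ) + 4) := 
              Real.log_nonneg (by
                have : (0 : ℝ) ≤ (2 * k + 1 : ℕ) := Nat.cast_nonneg _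
                linarith)
            gcongr
        _ = _ := by rw [hc]; ring
    calc _ ≤ c / 2 * ∫ x, x ^ k ∂μ + 1 / (2 * c) * ∫ x, x ^ (k + 1) ∂μ := h1
      _ ≤ c / 2 * (4 * logWeight (2 * k)) +
          1 / (2 * c) * (4 * (12 * c * logWeight (2 * k + 1))) := by
          gcongr
          · exact hW k
          · exact (hW (k + 1)).trans (by gcongr)
      _ = 2 * (c * logWeight (2 * k)) + 24 * logWeight (2 * k + 1) := by field_simp; ring
      _ ≤ _ := by linarith

/-- A distribution on the half-line whose moments are `O((2n)! (log (2n + 3)) ^ (2n))` is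
M-determinate. -/
theorem isMDeterminate_of_le_logWeight {μ : Measure ℝ} [IsProbabilityMeasure μ]
    (hμ : μ (Iio 0) = 0) (hm : HasFiniteMoments μ)
    (hW : ∀ k : ℕ, ∫ x, x ^ k ∂μ ≤ 4 * logWeight (2 * k)) : IsMDeterminate μ := by
  refine ⟨inferInstance, hμ, hm, fun ν _ hν hνm hmom => ?_⟩
  refine eq_of_moments_eq hμ hν hm hνm hmom (M := fun n => 26 * logWeight n)
    (l := fun n => Real.exp 1 * (((n : ℝ) + 1) * Real.log (n + 4)))
    (integral_sqrt_pow_le_logWeight hμ hm hW)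
    (integral_sqrt_pow_le_logWeight hν hνm fun k => (hmom k).trans_le (hW k))
    (fun n => ?_) (fun a b hab => ?_) (fun n => ?_) ?_
  · have := one_le_log_of_three_le (show (3 : ℝ) ≤ n + 4 by
      have : (0 : ℝ) ≤ n := n.cast_nonneg
      linarith)
    positivity
  · have h1 : (a : ℝ) ≤ b := by exact_mod_cast hab
    have := one_le_log_of_three_le (show (3 : ℝ) ≤ a + 4 by
      have : (0 : ℝ) ≤ a := a.cast_nonneg
      linarith)
    dsimp only
    gcongr
  · have := logWeight_succ_le n
    linarith
  · simp only [mul_inv (Real.exp 1), ← Finset.mul_sum]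
    exact tendsto_sum_inv_mul_log.const_mul_atTop (by positivity)

/-! ### The exponential law and the size of `K_n` -/

theorem expMeasure_one_eq_withDensity :
    expMeasure 1 = (volume.restrict (Ioi (0 : ℝ))).withDensity
      (fun x => ENNReal.ofReal (Real.exp (-x))) := by
  have h : gammaPDF 1 1 = (Ici (0 : ℝ)).indicator (fun x => ENNReal.ofReal (Real.exp (-x))) := by
    funext x
    rcases le_or_gt 0 x with hx | hx
    · rw [gammaPDF_of_nonneg hx, indicator_of_mem (mem_Ici.2 hx)]
      simp
    · rw [gammaPDF_of_neg hx, indicator_of_notMem (by simpa using hx)]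
  rw [expMeasure, gammaMeasure, h, withDensity_indicator measurableSet_Ici,
    ← Measure.restrict_congr_set Ioi_ae_eq_Ici]

theorem integral_expMeasure_one (g : ℝ → ℝ) :
    ∫ x, g x ∂expMeasure 1 = ∫ x in Ioi 0, g x * Real.exp (-x) := by
  rw [expMeasure_one_eq_withDensity, integral_withDensity_eq_integral_toReal_smul (by fun_prop)
    (ae_of_all _ fun x => ENNReal.ofReal_lt_top)]
  refine integral_congr_ae (ae_of_all _ fun x => ?_)
  simp only [ENNReal.toReal_ofReal (Real.exp_pos _).le, smul_eq_mul, mul_comm]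

theorem integrable_expMeasure_one_iff (g : ℝ → ℝ) :
    Integrable g (expMeasure 1) ↔ IntegrableOn (fun x => g x * Real.exp (-x)) (Ioi 0) := by
  rw [expMeasure_one_eq_withDensity, integrable_withDensity_iff (by fun_prop)
    (ae_of_all _ fun x => ENNReal.ofReal_lt_top), IntegrableOn]
  simp only [ENNReal.toReal_ofReal (Real.exp_pos _).le]

theorem ae_pos_expMeasure_one : ∀ᵐ x ∂expMeasure 1, (0 : ℝ) < x := by
  rw [expMeasure_one_eq_withDensity]
  exact (withDensity_absolutelyContinuous _ _).ae_le (ae_restrict_mem measurableSet_Ioi)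

theorem integrable_pow_expMeasure_one (n : ℕ) : Integrable (fun x => x ^ n) (expMeasure 1) := by
  rw [integrable_expMeasure_one_iff]
  have h := Real.GammaIntegral_convergent (show (0 : ℝ) < n + 1 by positivity)
  refine h.congr_fun (fun x _ => ?_) measurableSet_Ioi
  simp only [add_sub_cancel_right, Real.rpow_natCast, mul_comm]

theorem integral_pow_expMeasure_one (n : ℕ) : ∫ x, x ^ n ∂expMeasure 1 = n ! := by
  rw [integral_expMeasure_one, ← Real.Gamma_nat_eq_factorial,
    Real.Gamma_eq_integral (by positivity)]
  refine integral_congr_ae (ae_of_all _ fun x => ?_)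
  simp only [add_sub_cancel_right, Real.rpow_natCast, mul_comm]

/-- With `a = 2n + 3`, `log (1 + x) ≤ log a * (1 + x / a) ≤ log a * e^{x / a}`. The `n`-th power
costs at most `e^{x / 2}`, leaving half of the exponential decay. -/
theorem log_one_add_pow_mul_exp_le (n : ℕ) {x : ℝ} (hx : 0 < x) :
    Real.log (1 + x) ^ n * Real.exp (-x) ≤
      Real.log ((2 * n : ℕ) + 3) ^ n * Real.exp (-(1 / 2) * x) := by
  set a : ℝ := (2 * n : ℕ) + 3 with ha
  have hn : (0 : ℝ) ≤ n := n.cast_nonneg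
  have ha0 : 2 * (n : ℝ) + 3 = a := by rw [ha]; push_cast; ring
  have hL : 1 ≤ Real.log a := one_le_log_natCast_add_three _
  have h1 : Real.log (1 + x) ≤ Real.log a * (x / a + 1) := by
    have h := Real.log_le_sub_one_of_pos (show 0 < (1 + x) / a by positivity)
    rw [Real.log_div (by positivity) (by positivity), add_div] at h
    have h2 : 1 / a ≤ 1 := by rw [div_le_one] <;> linarith
    have h3 : x / a ≤ Real.log a * (x / a) := le_mul_of_one_le_left (by positivity) hL
    linarith
  have h0 : 0 ≤ Real.log (1 + x) := Real.log_nonneg (by linarith)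
  calc _ ≤ (Real.log a * Real.exp (x / a)) ^ n * Real.exp (-x) := by
        gcongr
        exact h1.trans (by gcongr; exact Real.add_one_le_exp _)
    _ = Real.log a ^ n * Real.exp (n * (x / a) + -x) := by
        rw [mul_pow, ← Real.exp_nat_mul, mul_assoc, ← Real.exp_add]
    _ ≤ _ := by
        gcongr
        have : n * (x / a) ≤ 1 / 2 * x := by
          rw [mul_div_assoc', div_le_iff₀ (by positivity)]
          nlinarith
        linarith

theorem integrableOn_log_one_add_pow (n : ℕ) :
    IntegrableOn (fun x => Real.log (1 + x) ^ n * Real.exp (-x)) (Ioi (0 : ℝ)) := by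
  have h := (integrableOn_exp_mul_Ioi (a := -(1 / 2)) (by norm_num) 0).const_mul
    (Real.log ((2 * n : ℕ) + 3) ^ n)
  refine h.mono' (by fun_prop) ?_
  filter_upwards [ae_restrict_mem measurableSet_Ioi] with x hx
  have h0 : 0 ≤ Real.log (1 + x) := Real.log_nonneg (by linarith [mem_Ioi.1 hx])
  rw [Real.norm_of_nonneg (by positivity)]
  exact log_one_add_pow_mul_exp_le n hx

theorem logMoment_le (n : ℕ) : logMoment n ≤ 2 * Real.log ((2 * n : ℕ) + 3) ^ n := by
  have h := (integrableOn_exp_mul_Ioi (a := -(1 / 2)) (by norm_num) 0).const_mul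
    (Real.log ((2 * n : ℕ) + 3) ^ n)
  calc logMoment n ≤ ∫ x in Ioi (0 : ℝ),
        Real.log ((2 * n : ℕ) + 3) ^ n * Real.exp (-(1 / 2) * x) :=
        setIntegral_mono_on (integrableOn_log_one_add_pow n) h measurableSet_Ioi
          fun x hx => log_one_add_pow_mul_exp_le n hx
    _ = _ := by
        rw [integral_const_mul, integral_exp_mul_Ioi (by norm_num)]
        norm_num
        ring

/-- Only the part of the integral beyond `s` is kept, where the logarithm is at least `log (1 + s)`.
Since `s` is free, `K_n` outgrows every geometric sequence. -/
theorem le_logMoment (n : ℕ) {s : ℝ} (hs : 0 ≤ s) :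
    Real.log (1 + s) ^ n * Real.exp (-s) ≤ logMoment n := by
  rw [← integral_exp_neg_Ioi s, ← integral_const_mul]
  have hsub : Ioi s ⊆ Ioi (0 : ℝ) := Ioi_subset_Ioi hs
  calc _ ≤ ∫ x in Ioi s, Real.log (1 + x) ^ n * Real.exp (-x) := by
        refine setIntegral_mono_on ((integrableOn_exp_neg_Ioi s).const_mul _)
          ((integrableOn_log_one_add_pow n).mono_set hsub) measurableSet_Ioi fun x hx => ?_
        have h0 : 0 ≤ Real.log (1 + s) := Real.log_nonneg (by linarith)
        have h1 : s ≤ x := le_of_lt hx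
        gcongr
    _ ≤ _ := by
        refine setIntegral_mono_set (integrableOn_log_one_add_pow n) ?_ hsub.eventuallyLE
        filter_upwards [ae_restrict_mem measurableSet_Ioi] with x hx
        have h0 : 0 ≤ Real.log (1 + x) := Real.log_nonneg (by linarith [mem_Ioi.1 hx])
        simp only [Pi.zero_apply]
        positivity

theorem logMoment_pos (n : ℕ) : 0 < logMoment n := by
  refine lt_of_lt_of_le ?_ (le_logMoment n zero_le_one)
  have : 0 < Real.log (1 + 1) := Real.log_pos (by norm_num)
  positivity

theorem not_quadraticGrowth_logMoment :
    ¬ QuadraticGrowth (fun n => ((n ! : ℝ) * logMoment n) ^ 2) := by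
  intro h
  obtain ⟨c, hc⟩ := h.bound
  obtain ⟨N, hN⟩ := eventually_atTop.1 hc
  set C := √|c| with hC
  have hstep : ∀ n ≥ N, logMoment (n + 1) ≤ C * logMoment n := by
    intro n hn
    have h1 := hN n hn
    have hf : (0 : ℝ) < n ! := by exact_mod_cast n.factorial_pos
    have hK := logMoment_pos n
    have hK' := logMoment_pos (n + 1)
    have hn0 : (0 : ℝ) ≤ n := n.cast_nonneg
    have e : (((n + 1)! : ℝ) * logMoment (n + 1)) ^ 2 / ((n ! : ℝ) * logMoment n) ^ 2 =
        (logMoment (n + 1) / logMoment n) ^ 2 * ((n : ℝ) + 1) ^ 2 := by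
      rw [Nat.factorial_succ]
      push_cast
      field_simp
    rw [e, Real.norm_of_nonneg (by positivity), Real.norm_of_nonneg (by positivity)] at h1
    have h2 : (logMoment (n + 1) / logMoment n) ^ 2 ≤ |c| :=
      (le_of_mul_le_mul_right h1 (by positivity)).trans (le_abs_self c)
    rw [← div_le_iff₀ hK]
    exact Real.le_sqrt_of_sq_le h2
  have hC0 : 0 ≤ C := Real.sqrt_nonneg _
  have hpow : ∀ k, logMoment (N + k) ≤ C ^ k * logMoment N := by
    intro k
    induction k with
    | zero => simp
    | succ k ih =>
      calc logMoment (N + k + 1) ≤ C * logMoment (N + k) := hstep _ (by omega)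
        _ ≤ C * (C ^ k * logMoment N) := by gcongr
        _ = _ := by ring
  -- Chosen so that `log (1 + s) = 2 (C + 1)`, which beats the rate `C` by a factor of at least `2`
  -- per step.
  set s := Real.exp (2 * (C + 1)) - 1 with hs
  have hs0 : 0 ≤ s := sub_nonneg.2 (Real.one_le_exp (by positivity))
  have hlow : ∀ k, (2 * (C + 1)) ^ (N + k) * Real.exp (-s) ≤ C ^ k * logMoment N := by
    intro k
    have := le_logMoment (N + k) hs0
    rw [hs, add_sub_cancel, Real.log_exp] at this
    exact this.trans (hpow k)
  have hbdd : ∀ k, (2 : ℝ) ^ k * ((2 * (C + 1)) ^ N * Real.exp (-s)) ≤ logMoment N := by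
    intro k
    refine le_of_mul_le_mul_left ?_ (show 0 < (C + 1) ^ k by positivity)
    calc _ = (2 * (C + 1)) ^ (N + k) * Real.exp (-s) := by rw [pow_add, mul_pow 2 (C + 1) k]; ring
      _ ≤ C ^ k * logMoment N := hlow k
      _ ≤ _ := by
        have := logMoment_pos N
        gcongr
        linarith
  have hlim : Tendsto (fun k : ℕ => (2 : ℝ) ^ k * ((2 * (C + 1)) ^ N * Real.exp (-s))) atTop atTop :=
    (tendsto_pow_atTop_atTop_of_one_lt one_lt_two).atTop_mul_const (by positivity)
  obtain ⟨k, hk⟩ := (hlim.eventually_gt_atTop (logMoment N)).exists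
  exact absurd (hbdd k) (not_le.2 hk)

/-- Since `(k!)^2` divides `(2k)!`, the squared moment fits the weight at index `2k`, the order at
which `√x` produces the `k`-th moment. -/
theorem factorial_mul_logMoment_sq_le (k : ℕ) :
    ((k ! : ℝ) * logMoment k) ^ 2 ≤ 4 * logWeight (2 * k) := by
  have hK := logMoment_pos k
  have hf : ((k ! : ℝ)) * k ! ≤ (2 * k)! := by
    rw [two_mul]
    exact_mod_cast Nat.le_of_dvd (Nat.factorial_pos _)
      (Nat.factorial_mul_factorial_dvd_factorial_add k k)
  calc _ ≤ ((k ! : ℝ) * (2 * Real.log ((2 * k : ℕ) + 3) ^ k)) ^ 2 := by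
        gcongr
        exact logMoment_le k
    _ = 4 * ((k ! : ℝ) * k ! * Real.log ((2 * k : ℕ) + 3) ^ (2 * k)) := by ring
    _ ≤ _ := by
        have := one_le_log_natCast_add_three (2 * k)
        unfold logWeight
        gcongr

theorem carlemanCondition_logMoment :
    CarlemanCondition (fun n => ((n ! : ℝ) * logMoment n) ^ 2) := by
  have hterm : ∀ n : ℕ, 1 / 4 * (((n : ℝ) + 1) * Real.log (n + 4))⁻¹ ≤
      ((((n + 1)! : ℝ) * logMoment (n + 1)) ^ 2) ^ (-(1 / (2 * ((n + 1 : ℕ) : ℝ)))) := by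
    intro n
    have hn : (0 : ℝ) ≤ n := n.cast_nonneg
    have hK := logMoment_pos (n + 1)
    have hL := one_le_log_natCast_add_three (2 * (n + 1))
    have hf : ((n + 1)! : ℝ) ≤ ((n : ℝ) + 1) ^ (n + 1) := by
      exact_mod_cast Nat.factorial_le_pow (n + 1)
    have hf0 : (0 : ℝ) < (n + 1)! := by exact_mod_cast (n + 1).factorial_pos
    set L := Real.log ((2 * (n + 1) : ℕ) + 3) with hLdef
    have hLle : L ≤ 2 * Real.log ((n : ℝ) + 4) := by
      rw [hLdef, ← Nat.cast_two (R := ℝ), ← Real.log_pow]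
      refine Real.log_le_log (by positivity) ?_
      push_cast
      nlinarith
    have h1 : (((n + 1)! : ℝ) * logMoment (n + 1)) ^ 2 ≤
        (2 * ((n : ℝ) + 1) * L) ^ (2 * (n + 1)) := by
      rw [mul_comm 2 (n + 1), pow_mul]
      -- The constant `2` of `logMoment_le` is absorbed into the base, so that the root can be taken
      -- exactly.
      have h2 : (2 : ℝ) ≤ 2 ^ (n + 1) := le_self_pow₀ one_le_two (by omega)
      gcongr
      calc ((n + 1)! : ℝ) * logMoment (n + 1) ≤ ((n : ℝ) + 1) ^ (n + 1) * (2 * L ^ (n + 1)) := by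
            gcongr
            exact logMoment_le (n + 1)
        _ ≤ ((n : ℝ) + 1) ^ (n + 1) * (2 ^ (n + 1) * L ^ (n + 1)) := by gcongr
        _ = _ := by rw [mul_pow, mul_pow]; ring
    calc 1 / 4 * (((n : ℝ) + 1) * Real.log (n + 4))⁻¹
        = (2 * ((n : ℝ) + 1) * (2 * Real.log (n + 4)))⁻¹ := by
          rw [show 2 * ((n : ℝ) + 1) * (2 * Real.log (n + 4)) =
            4 * (((n : ℝ) + 1) * Real.log (n + 4)) by ring, mul_inv 4, one_div]
      _ ≤ (2 * ((n : ℝ) + 1) * L)⁻¹ := by gcongr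
      _ = ((2 * ((n : ℝ) + 1) * L) ^ (2 * (n + 1))) ^ (-(1 / (2 * ((n + 1 : ℕ) : ℝ)))) := by
          rw [Real.rpow_neg (by positivity), one_div]
          have e : (2 * ((n + 1 : ℕ) : ℝ)) = ((2 * (n + 1) : ℕ) : ℝ) := by push_cast; ring
          rw [e, Real.pow_rpow_inv_natCast (by positivity) (by omega)]
      _ ≤ _ := Real.rpow_le_rpow_of_nonpos (by positivity) h1 (neg_nonpos.2 (by positivity))
  unfold CarlemanCondition
  have hlim := tendsto_sum_inv_mul_log.const_mul_atTop (show (0 : ℝ) < 1 / 4 by norm_num)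
  refine tendsto_atTop_mono (fun N => ?_) hlim
  rw [Finset.mul_sum, ← Finset.Ico_succ_right_eq_Icc, Finset.sum_Ico_eq_sum_range]
  refine (Finset.sum_le_sum fun n _ => hterm n).trans (le_of_eq ?_)
  simp [add_comm]

/-! ### Independent exponential variables and the product `X` -/

theorem IsIIDStdExp.map_fun_eq_pi {Ω ι : Type*} [Fintype ι] [MeasurableSpace Ω] {P : Measure Ω}
    {ζ : ι → Ω → ℝ} (h : IsIIDStdExp P ζ) :
    P.map (fun ω i => ζ i ω) = Measure.pi (fun _ : ι => expMeasure 1) := by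
  rw [h.indep.map_fun_eq_pi_map fun i => (h.measurable i).aemeasurable]
  simp only [h.law]

theorem IsIIDStdExp.integrable_prod {Ω ι : Type*} [Fintype ι] [MeasurableSpace Ω] {P : Measure Ω}
    {ζ : ι → Ω → ℝ} (h : IsIIDStdExp P ζ) {g : ι → ℝ → ℝ}
    (hg : ∀ i, Integrable (g i) (expMeasure 1)) :
    Integrable (fun ω => ∏ i, g i (ζ i ω)) P := by
  have := isProbabilityMeasure_expMeasure one_pos
  have hm : Measurable (fun ω i => ζ i ω) := measurable_pi_lambda _ h.measurable
  have hi := Integrable.fintype_prod (f := g) hg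
  rw [← h.map_fun_eq_pi] at hi
  exact hi.comp_measurable hm

theorem IsIIDStdExp.integral_prod {Ω ι : Type*} [Fintype ι] [MeasurableSpace Ω] {P : Measure Ω}
    {ζ : ι → Ω → ℝ} (h : IsIIDStdExp P ζ) {g : ι → ℝ → ℝ}
    (hg : ∀ i, Integrable (g i) (expMeasure 1)) :
    ∫ ω, ∏ i, g i (ζ i ω) ∂P = ∏ i, ∫ x, g i x ∂expMeasure 1 := by
  rw [h.indep.integral_fun_prod_comp (fun i => (h.measurable i).aemeasurable)
    (fun i => by rw [h.law i]; exact (hg i).aestronglyMeasurable)]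
  refine Finset.prod_congr rfl fun i _ => ?_
  rw [← h.law i, integral_map (h.measurable i).aemeasurable
    (by rw [h.law i]; exact (hg i).aestronglyMeasurable)]

theorem IsIIDStdExp.ae_pos {Ω ι : Type*} [MeasurableSpace Ω] {P : Measure Ω}
    {ζ : ι → Ω → ℝ} (h : IsIIDStdExp P ζ) (i : ι) : ∀ᵐ ω ∂P, 0 < ζ i ω := by
  have h1 := ae_pos_expMeasure_one
  rw [← h.law i] at h1
  exact ae_of_ae_map (h.measurable i).aemeasurable h1

theorem isIIDStdExp_pi : IsIIDStdExp (Measure.pi (fun _ : Fin 4 => expMeasure 1))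
    (fun i ω => ω i) := by
  have := isProbabilityMeasure_expMeasure one_pos
  exact ⟨fun i => measurable_pi_apply i, fun i => (measurePreserving_eval _ i).map_eq,
    iIndepFun_pi (X := fun _ => id) fun _ => aemeasurable_id⟩

theorem integrable_log_one_add_pow_expMeasure_one (n : ℕ) :
    Integrable (fun x => Real.log (1 + x) ^ n) (expMeasure 1) :=
  (integrable_expMeasure_one_iff _).2 (integrableOn_log_one_add_pow n)

theorem measurable_logProduct {Ω : Type*} [MeasurableSpace Ω] {P : Measure Ω}
    {ξ₁ η₁ ξ₂ η₂ : Ω → ℝ} (h : IsIIDStdExp P ![ξ₁, η₁, ξ₂, η₂]) :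
    Measurable (logProduct ξ₁ η₁ ξ₂ η₂) := by
  have h0 : Measurable ξ₁ := h.measurable 0
  have h1 : Measurable η₁ := h.measurable 1
  have h2 : Measurable ξ₂ := h.measurable 2
  have h3 : Measurable η₂ := h.measurable 3
  unfold logProduct
  fun_prop

theorem ae_pos_logProduct {Ω : Type*} [MeasurableSpace Ω] {P : Measure Ω}
    {ξ₁ η₁ ξ₂ η₂ : Ω → ℝ} (h : IsIIDStdExp P ![ξ₁, η₁, ξ₂, η₂]) :
    ∀ᵐ ω ∂P, 0 < logProduct ξ₁ η₁ ξ₂ η₂ ω := by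
  filter_upwards [h.ae_pos 0, h.ae_pos 1, h.ae_pos 2, h.ae_pos 3] with ω (h0 : 0 < ξ₁ ω)
    (h1 : 0 < η₁ ω) (h2 : 0 < ξ₂ ω) (h3 : 0 < η₂ ω)
  have hl1 : 0 < Real.log (1 + η₁ ω) := Real.log_pos (by linarith)
  have hl2 : 0 < Real.log (1 + η₂ ω) := Real.log_pos (by linarith)
  unfold logProduct
  positivity

theorem logProduct_moment {Ω : Type*} [MeasurableSpace Ω] {P : Measure Ω}
    {ξ₁ η₁ ξ₂ η₂ : Ω → ℝ} (h : IsIIDStdExp P ![ξ₁, η₁, ξ₂, η₂]) (n : ℕ) :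
    Integrable (fun ω => logProduct ξ₁ η₁ ξ₂ η₂ ω ^ n) P ∧
      ∫ ω, logProduct ξ₁ η₁ ξ₂ η₂ ω ^ n ∂P = ((n ! : ℝ) * logMoment n) ^ 2 := by
  set g : Fin 4 → ℝ → ℝ := ![fun x => x ^ n, fun x => Real.log (1 + x) ^ n, fun x => x ^ n,
    fun x => Real.log (1 + x) ^ n] with hgdef
  have hg : ∀ i, Integrable (g i) (expMeasure 1) := by
    intro i
    fin_cases i
    · exact integrable_pow_expMeasure_one n
    · exact integrable_log_one_add_pow_expMeasure_one n
    · exact integrable_pow_expMeasure_one n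
    · exact integrable_log_one_add_pow_expMeasure_one n
  have e : (fun ω => logProduct ξ₁ η₁ ξ₂ η₂ ω ^ n) =
      fun ω => ∏ i, g i (![ξ₁, η₁, ξ₂, η₂] i ω) := by
    funext ω
    rw [Fin.prod_univ_four]
    change _ = ξ₁ ω ^ n * Real.log (1 + η₁ ω) ^ n * ξ₂ ω ^ n * Real.log (1 + η₂ ω) ^ n
    unfold logProduct
    ring
  have hlog : ∫ x, Real.log (1 + x) ^ n ∂expMeasure 1 = logMoment n :=
    integral_expMeasure_one _
  rw [e]
  refine ⟨h.integrable_prod hg, ?_⟩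
  rw [h.integral_prod hg, Fin.prod_univ_four]
  change (∫ x, x ^ n ∂expMeasure 1) * (∫ x, Real.log (1 + x) ^ n ∂expMeasure 1) *
    (∫ x, x ^ n ∂expMeasure 1) * (∫ x, Real.log (1 + x) ^ n ∂expMeasure 1) = _
  rw [hlog, integral_pow_expMeasure_one]
  ring

theorem isMDeterminate_logProduct {Ω : Type*} [MeasurableSpace Ω] {P : Measure Ω}
    [IsProbabilityMeasure P] {ξ₁ η₁ ξ₂ η₂ : Ω → ℝ} (h : IsIIDStdExp P ![ξ₁, η₁, ξ₂, η₂]) :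
    IsMDeterminate (P.map (logProduct ξ₁ η₁ ξ₂ η₂)) := by
  have hX := measurable_logProduct h
  have := Measure.isProbabilityMeasure_map (μ := P) hX.aemeasurable
  refine isMDeterminate_of_le_logWeight ?_ (fun n => ?_) (fun k => ?_)
  · rw [Measure.map_apply hX measurableSet_Iio]
    refine measure_eq_zero_iff_ae_notMem.2 ?_
    filter_upwards [ae_pos_logProduct h] with ω hω
    simpa using hω.le
  · exact (integrable_map_measure (by fun_prop) hX.aemeasurable).2 (logProduct_moment h n).1
  · rw [integral_map hX.aemeasurable (by fun_prop), (logProduct_moment h k).2]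
    exact factorial_mul_logMoment_sq_le k

theorem logProduct_carleman_and_not_quadraticGrowth {Ω : Type*} [MeasurableSpace Ω] {P : Measure Ω}
    [IsProbabilityMeasure P] {ξ₁ η₁ ξ₂ η₂ : Ω → ℝ} (h : IsIIDStdExp P ![ξ₁, η₁, ξ₂, η₂]) :
    CarlemanCondition (fun n => ∫ ω, logProduct ξ₁ η₁ ξ₂ η₂ ω ^ n ∂P) ∧
      ¬ QuadraticGrowth (fun n => ∫ ω, logProduct ξ₁ η₁ ξ₂ η₂ ω ^ n ∂P) := by
  simp only [(logProduct_moment h _).2]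
  exact ⟨carlemanCondition_logMoment, not_quadraticGrowth_logMoment⟩

theorem theorem4 :
    -- There is a positive M-determinate random variable with the required properties,
    -- and it may be taken of the form `ξ₁ ln(1 + η₁) · ξ₂ ln(1 + η₂)`.
    (∃ (Ω : Type) (_ : MeasurableSpace Ω) (P : Measure Ω) (_ : IsProbabilityMeasure P)
      (X ξ₁ η₁ ξ₂ η₂ : Ω → ℝ),
      IsIIDStdExp P ![ξ₁, η₁, ξ₂, η₂] ∧
      X = logProduct ξ₁ η₁ ξ₂ η₂ ∧
      Measurable X ∧
      (∀ᵐ ω ∂P, 0 < X ω) ∧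
      IsMDeterminate (P.map X) ∧
      CarlemanCondition (fun n => ∫ ω, X ω ^ n ∂P) ∧
      ¬ QuadraticGrowth (fun n => ∫ ω, X ω ^ n ∂P)) ∧
    -- Every random variable of this form, on any probability space, has these properties,
    -- and its moments are `(n! K_n)^2`.
    (∀ (Ω : Type*) [MeasurableSpace Ω] (P : Measure Ω) [IsProbabilityMeasure P]
      (ξ₁ η₁ ξ₂ η₂ X : Ω → ℝ),
      IsIIDStdExp P ![ξ₁, η₁, ξ₂, η₂] →
      X = logProduct ξ₁ η₁ ξ₂ η₂ →
      Measurable X ∧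
      (∀ᵐ ω ∂P, 0 < X ω) ∧
      (∀ n : ℕ, Integrable (fun ω => X ω ^ n) P ∧
        ∫ ω, X ω ^ n ∂P = ((n ! : ℝ) * logMoment n) ^ 2) ∧
      IsMDeterminate (P.map X) ∧
      CarlemanCondition (fun n => ∫ ω, X ω ^ n ∂P) ∧
      ¬ QuadraticGrowth (fun n => ∫ ω, X ω ^ n ∂P)) := by
  constructor
  · have := isProbabilityMeasure_expMeasure one_pos
    have h : IsIIDStdExp (Measure.pi (fun _ : Fin 4 => expMeasure 1))
        ![fun ω => ω 0, fun ω => ω 1, fun ω => ω 2, fun ω => ω 3] := by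
      have e : ![fun ω : Fin 4 → ℝ => ω 0, fun ω => ω 1, fun ω => ω 2, fun ω => ω 3] =
          fun i ω => ω i := by
        funext i
        fin_cases i <;> rfl
      rw [e]
      exact isIIDStdExp_pi
    exact ⟨Fin 4 → ℝ, inferInstance, Measure.pi (fun _ => expMeasure 1), inferInstance,
      _, _, _, _, _, h, rfl, measurable_logProduct h, ae_pos_logProduct h,
      isMDeterminate_logProduct h, logProduct_carleman_and_not_quadraticGrowth h⟩
  · rintro Ω _ P _ ξ₁ η₁ ξ₂ η₂ X h rfl
    exact ⟨measurable_logProduct h, ae_pos_logProduct h, logProduct_moment h,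
      isMDeterminate_logProduct h, logProduct_carleman_and_not_quadraticGrowth h⟩
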